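/- Let $G$ be a connected Lie group with universal cover $\tilde G$, regard $\pi_1(G)$ as a central subgroup of $\tilde G$, and let $G^\delta$ be $G$ with the discrete topology. Let $o^\delta(EG)\in H^2(BG^\delta,\pi_1(G))$ be the pull-back to $BG^\delta$ of the primary obstruction $o(EG)\in H^2(BG,\pi_1(G))$ to a section of the universal $G$-bundle $EG\to BG$; equivalently, by naturality, the primary obstruction to a section of the flat $G$-bundle $EG^\delta\times_{G^\delta}G\to BG^\delta$. Let $|\cdot|$ be the word length on the finitely generated abelian group $\pi_1(G)$ with respect to some finite symmetric generating set (or, if $\pi_1(G)$ is realized as a discrete subgroup of some $\mathbb R^r$, the restriction of the Euclidean norm). For a class $\alpha\in H^2(BG^\delta,\pi_1(G))=H^2(G^\delta,\pi_1(G))$ put $$\|\alpha\|_\infty=\inf_{[c]=\alpha}\ \sup_{g,h\in G}|c(g,h)|\in[0,\infty],$$ the infimum over all cocycles $c:G\times G\to\pi_1(G)$ representing $\alpha$, and call $\alpha$ bounded if it is represented by a cocycle with bounded image. For $z\in[\tilde G,\tilde G]$ let $\mathrm{cl}(z)$ be the least number of commutators of elements of $\tilde G$ whose product is $z$, and $\mathrm{scl}(z)=\lim_{n\to\infty}\mathrm{cl}(z^n)/n$.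 Assume that $o^\delta(EG)$ is bounded, and let $z\in\pi_1(G)$ be an element of infinite order that lies in $[\tilde G,\tilde G]$. Then the limits $\mathrm{scl}(z)$ and $\lim_{n\to\infty}|z^n|/n$ exist, and $$\mathrm{scl}(z)\ \ge\ \frac{1}{4\,\|o^\delta(EG)\|_\infty}\,\lim_{n\to\infty}\frac{|z^n|}{n}\ >\ 0 .$$ -/

import Mathlib

open Filter Topology
open scoped unitInterval Manifold ContDiff

universe u

namespace FlatObstruction

noncomputable section

/-! ### Commutator length, stable commutator length, word length -/

/-- The commutator length of `z` in the group `H`: the smallest number of commutators whose product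
is `z` (only meaningful for `z` in the commutator subgroup of `H`). -/
def commutatorLength {H : Type*} [Group H] (z : H) : ℕ :=
  sInf {k | ∃ l : List (H × H), l.length = k ∧
    (l.map fun p => p.1 * p.2 * p.1⁻¹ * p.2⁻¹).prod = z}

/-- The stable commutator length `lim cl(zⁿ)/n`. -/
def stableCommutatorLength {H : Type*} [Group H] (z : H) : ℝ :=
  limUnder atTop fun n : ℕ => (commutatorLength (z ^ n) : ℝ) / n

/-- The word length of `h` with respect to `S`: the smallest number of elements of `S`
(a finite symmetric generating set in all uses) needed to express `h`. -/
def wordLength {H : Type*} [Group H] (S : Finset H) (h : H) : ℕ :=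
  sInf {k | ∃ l : List H, l.length = k ∧ (∀ x ∈ l, x ∈ S) ∧ l.prod = h}

/-- The length functions that are used on a finitely generated abelian group `A`: the word length
with respect to a finite symmetric generating set and, when `A` is realized as a discrete subgroup
of some `ℝ^r`, the restriction of the Euclidean norm. -/
inductive IsStandardLength {A : Type*} [CommGroup A] : (A → ℝ) → Prop
  | word (S : Finset A) (symm : ∀ s ∈ S, s⁻¹ ∈ S) (gen : Subgroup.closure (S : Set A) = ⊤) :
      IsStandardLength fun a => (wordLength S a : ℝ)
  | euclidean (r : ℕ) (φ : Additive A →+ EuclideanSpace ℝ (Fin r)) (inj : Function.Injective φ)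
      (discrete : DiscreteTopology φ.range) :
      IsStandardLength fun a => ‖φ (Additive.ofMul a)‖

/-- The limit `lim |zⁿ|/n` for a length function `|·|`. -/
def stableLength {H : Type*} [Group H] (len : H → ℝ) (z : H) : ℝ :=
  limUnder atTop fun n : ℕ => len (z ^ n) / n

/-! ### Bounded classes in degree-two group cohomology -/

section Cohomology

variable {Γ A : Type u} [Group Γ] [CommGroup A]

/-- `A` as a trivial `Γ`-module. The ring of scalars is `ℤ`, lifted to the universe of `Γ`. -/
abbrev trivialModule (Γ A : Type u) [Group Γ] [CommGroup A] : Rep.{u} (ULift.{u} ℤ) Γ :=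
  Rep.trivial (ULift.{u} ℤ) Γ (Additive A)

/-- `H²(Γ, A) = H²(BΓ, A)` for the discrete group `Γ` and trivial coefficients `A`. -/
abbrev H2 (Γ A : Type u) [Group Γ] [CommGroup A] : Type u :=
  groupCohomology.H2 (trivialModule Γ A)

/-- The inhomogeneous two-cocycles `Γ × Γ → A`. -/
abbrev Cocycle (Γ A : Type u) [Group Γ] [CommGroup A] : Type u :=
  groupCohomology.cocycles₂ (trivialModule Γ A)

/-- The cohomology class of a two-cocycle. -/
def Cocycle.toClass (c : Cocycle Γ A) : H2 Γ A :=
  groupCohomology.H2π (trivialModule Γ A) c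

/-- The value of a two-cocycle, as an element of the (multiplicatively written) group `A`. -/
def Cocycle.val (c : Cocycle Γ A) (g h : Γ) : A :=
  Additive.toMul (α := A) (c (g, h))

/-- A class is bounded if it is represented by a cocycle with bounded image, for the length
function `len` on `A`. -/
def IsBoundedClass (len : A → ℝ) (α : H2 Γ A) : Prop :=
  ∃ c : Cocycle Γ A, c.toClass = α ∧ ∃ C : ℝ, ∀ g h, len (c.val g h) ≤ C

/-- `‖α‖_∞`: the infimum, over all cocycles representing `α`, of the supremum of the length of
the values (lengths are nonnegative). -/
def supNorm (len : A → ℝ) (α : H2 Γ A) : ENNReal :=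
  ⨅ (c : Cocycle Γ A) (_ : c.toClass = α), ⨆ (g : Γ) (h : Γ), ENNReal.ofReal (len (c.val g h))

end Cohomology

/-! ### The universal cover of a topological group -/

section UniversalCover

theorem homotopic_trans_refl {X : Type*} [TopologicalSpace X] {x y : X} (p : Path x y) :
    p.Homotopic (p.trans (Path.refl y)) :=
  ⟨(Path.Homotopy.transRefl p).symm⟩

theorem homotopic_refl_trans {X : Type*} [TopologicalSpace X] {x y : X} (p : Path x y) :
    p.Homotopic ((Path.refl x).trans p) :=
  ⟨(Path.Homotopy.reflTrans p).symm⟩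

variable (G : Type u) [TopologicalSpace G] [Group G] [IsTopologicalGroup G]

/-- The group, under pointwise multiplication, of the paths in `G` that start at `1`. -/
def basedPaths : Subgroup C(I, G) where
  carrier := {f | f 0 = 1}
  one_mem' := rfl
  mul_mem' := by
    intro a b ha hb
    simp only [Set.mem_ofPred_eq] at ha hb ⊢
    simp [ha, hb]
  inv_mem' := by
    intro a ha
    simp only [Set.mem_ofPred_eq] at ha ⊢
    simp [ha]

/-- Homotopy of paths relative to the end points is a congruence on the group of paths. -/
def homotopyCon : Con (basedPaths G) where
  r f g := ContinuousMap.HomotopicRel (f : C(I, G)) (g : C(I, G)) {0, 1}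
  iseqv :=
    ⟨fun f => ContinuousMap.HomotopicRel.refl _, fun h => h.symm, fun h h' => h.trans h'⟩
  mul' := by
    rintro a b c d ⟨F⟩ ⟨F'⟩
    refine ⟨⟨⟨⟨fun x => F x * F' x, by fun_prop⟩, ?_, ?_⟩, ?_⟩⟩
    · intro x
      simp
    · intro x
      simp
    · intro t x hx
      have h1 := F.prop' t x hx
      have h2 := F'.prop' t x hx
      simp only [ContinuousMap.coe_mk] at h1 h2 ⊢
      exact congrArg₂ (· * ·) h1 h2

/-- The universal cover of `G`, as an abstract group: homotopy classes, relative to the end points,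
of the paths in `G` starting at `1`, with pointwise multiplication. (Commutators, and hence the
stable commutator length, do not involve its topology.) -/
def UniversalCover : Type u := (homotopyCon G).Quotient

instance : Group (UniversalCover G) := inferInstanceAs (Group (homotopyCon G).Quotient)

variable {G}

/-- The point of the universal cover given by a path starting at `1`. -/
def ofPath {g : G} (p : Path (1 : G) g) : UniversalCover G :=
  (homotopyCon G).mk' ⟨p.toContinuousMap, p.source⟩

variable (G) in
/-- The covering homomorphism: a path is sent to its end point. -/
def coveringMap : UniversalCover G →* G :=
  (homotopyCon G).lift
    { toFun := fun f => f.1 1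
      map_one' := rfl
      map_mul' := fun _ _ => rfl }
    (by
      rintro f g ⟨F⟩
      have h := F.eq_fst 1 (x := 1) (by simp)
      rw [F.apply_one] at h
      exact h.symm)

theorem ofPath_eq_iff {g : G} {p q : Path (1 : G) g} : ofPath p = ofPath q ↔ p.Homotopic q :=
  (homotopyCon G).eq

/-- The path `g · p` from `g` to `g h`, for a path `p` from `1` to `h`. -/
def translate (g : G) {h : G} (p : Path (1 : G) h) : Path g (g * h) :=
  (p.map (continuous_const_mul g)).cast (mul_one g).symm rfl

theorem ofPath_mul_of {g h k : G} {p p' : Path 1 g} {q q' : Path 1 h} {r : Path 1 k}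
    (hp : p.Homotopic p') (hq : q.Homotopic q') (hr : ∀ t, r t = p' t * q' t) :
    ofPath p * ofPath q = ofPath r := by
  rw [ofPath_eq_iff.2 hp, ofPath_eq_iff.2 hq]
  refine congrArg (homotopyCon G).mk' (Subtype.ext (ContinuousMap.ext fun t => ?_))
  exact (hr t).symm

theorem ofPath_mul {g h : G} (p : Path (1 : G) g) (q : Path (1 : G) h) :
    ofPath p * ofPath q = ofPath (p.trans (translate g q)) := by
  refine ofPath_mul_of (homotopic_trans_refl p) (homotopic_refl_trans q) fun t => ?_
  simp only [Path.trans_apply, translate]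
  split_ifs <;> simp

theorem ofPath_loop_mul {g : G} (l : Path (1 : G) 1) (p : Path (1 : G) g) :
    ofPath l * ofPath p = ofPath (l.trans p) := by
  refine ofPath_mul_of (homotopic_trans_refl l) (homotopic_refl_trans p) fun t => ?_
  simp only [Path.trans_apply]
  split_ifs <;> simp

theorem ofPath_mul_loop {g : G} (l : Path (1 : G) 1) (p : Path (1 : G) g) :
    ofPath p * ofPath l = ofPath (l.trans p) := by
  refine ofPath_mul_of (homotopic_refl_trans p) (homotopic_trans_refl l) fun t => ?_
  simp only [Path.trans_apply]
  split_ifs <;> simp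

theorem ofPath_surjective (x : UniversalCover G) :
    ∃ (g : G) (p : Path (1 : G) g), ofPath p = x := by
  obtain ⟨f, rfl⟩ := (homotopyCon G).mk'_surjective x
  exact ⟨f.1 1, ⟨f.1, f.2, rfl⟩, rfl⟩

/-- The natural embedding of `π₁(G) = π₁(G, 1)` in the universal cover: a loop at `1` is, in
particular, a path starting at `1`. -/
def toCover : FundamentalGroup G 1 →* UniversalCover G where
  toFun := Quotient.lift (fun l : Path (1 : G) 1 => ofPath l) fun _ _ h => ofPath_eq_iff.2 h
  map_one' := rfl
  map_mul' := by
    intro a b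
    induction a using Quotient.inductionOn with | _ p
    induction b using Quotient.inductionOn with | _ q
    exact (ofPath_mul_loop q p).symm

theorem toCover_injective : Function.Injective (toCover (G := G)) := by
  intro a b
  induction a using Quotient.inductionOn with | _ p
  induction b using Quotient.inductionOn with | _ q
  exact fun h => Quotient.sound (ofPath_eq_iff.1 h)

theorem toCover_central (a : FundamentalGroup G 1) (x : UniversalCover G) :
    toCover a * x = x * toCover a := by
  obtain ⟨g, p, rfl⟩ := ofPath_surjective x
  induction a using Quotient.inductionOn with | _ l
  exact (ofPath_loop_mul l p).trans (ofPath_mul_loop l p).symm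

/-- The image of `π₁(G)` in the universal cover is the kernel of the covering homomorphism. -/
theorem range_toCover : (toCover (G := G)).range = (coveringMap G).ker := by
  ext x
  constructor
  · rintro ⟨a, rfl⟩
    induction a using Quotient.inductionOn with | _ l
    exact l.target
  · intro hx
    obtain ⟨g, p, rfl⟩ := ofPath_surjective x
    obtain rfl : g = 1 := p.target.symm.trans hx
    exact ⟨FundamentalGroup.fromPath (Path.Homotopic.Quotient.mk p), rfl⟩

/-- The fundamental group of a topological group is commutative. -/
instance : CommGroup (FundamentalGroup G (1 : G)) :=
  { (inferInstance : Group (FundamentalGroup G (1 : G))) with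
    mul_comm := fun a b => toCover_injective <| by
      rw [map_mul, map_mul]
      exact toCover_central a _ }

end UniversalCover

/-! ### The class `o^δ(EG)`

The pull-back to `BG^δ` of the universal `G`-bundle is the flat bundle `EG^δ ×_{G^δ} G → BG^δ`, and
its sections over a subcomplex of `BG^δ` are the `G`-equivariant maps to `G` (with the action by
left translations) from the part of `EG^δ` above that subcomplex. We use the bar construction for
`EG^δ → BG^δ`: the `n`-simplices of `EG^δ` are the `(n+1)`-tuples in `G`, the vertex `g` is sent
to `g`, and an equivariant map on the one-skeleton amounts to a path `γ g` from `1` to `g` for each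
`g`, the edge `(a, a g)` being sent to `a · γ g`. The obstruction to extending this section over
the two-simplex `(1, g, g h)` is the class in `π₁(G)` of the image of its boundary, and the class in
`H²(BG^δ, π₁(G))` of this obstruction cocycle is the primary obstruction to a section. -/

section Obstruction

variable {G : Type u} [TopologicalSpace G] [Group G] [IsTopologicalGroup G]

/-- The obstruction cochain of a section over the one-skeleton: on the two-simplex `(1, g, g h)` it
is the class of the loop which runs along `γ g` from `1` to `g`, then along `g · γ h` from `g` to
`g h`, and then back to `1` along `γ (g h)`. -/
def obstructionCochain (γ : ∀ g : G, Path (1 : G) g) (g h : G) : FundamentalGroup G 1 :=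
  FundamentalGroup.fromPath <| Path.Homotopic.Quotient.mk <|
    ((γ g).trans (translate g (γ h))).trans (γ (g * h)).symm

theorem toCover_obstructionCochain (γ : ∀ g : G, Path (1 : G) g) (g h : G) :
    toCover (obstructionCochain γ g h) * ofPath (γ (g * h)) = ofPath (γ g) * ofPath (γ h) := by
  rw [ofPath_mul]
  refine (ofPath_loop_mul _ _).trans (ofPath_eq_iff.2 ?_)
  rw [← Path.Homotopic.Quotient.eq]
  simp [Path.Homotopic.Quotient.trans_assoc]

/-- The obstruction cochain is a cocycle. -/
def obstructionCocycle (γ : ∀ g : G, Path (1 : G) g) : Cocycle G (FundamentalGroup G (1 : G)) :=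
  ⟨fun p => Additive.ofMul (obstructionCochain γ p.1 p.2), by
    refine (groupCohomology.mem_cocycles₂_iff _).2 ?_
    intro g h j
    refine Additive.toMul.injective ?_
    change obstructionCochain γ (g * h) j * obstructionCochain γ g h =
      obstructionCochain γ h j * obstructionCochain γ g (h * j)
    refine toCover_injective ?_
    rw [map_mul, map_mul, ← mul_left_inj (ofPath (γ (g * h * j)))]
    have e1 := toCover_obstructionCochain γ g h
    have e2 := toCover_obstructionCochain γ (g * h) j
    have e3 := toCover_obstructionCochain γ h j
    have e4 := toCover_obstructionCochain γ g (h * j)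
    rw [toCover_central, mul_assoc, e2, ← mul_assoc, e1, mul_assoc, mul_assoc (toCover _),
      mul_assoc g h j, e4, ← mul_assoc, toCover_central, mul_assoc (ofPath _) _ (toCover _),
      ← toCover_central, e3, mul_assoc]⟩

/-- The class of the obstruction cocycle does not depend on the section over the one-skeleton. -/
theorem obstructionCocycle_toClass_eq (γ γ' : ∀ g : G, Path (1 : G) g) :
    (obstructionCocycle γ).toClass = (obstructionCocycle γ').toClass := by
  refine (groupCohomology.H2π_eq_iff _ _).2 ?_
  let b : G → FundamentalGroup G (1 : G) := fun g =>
    FundamentalGroup.fromPath (Path.Homotopic.Quotient.mk ((γ g).trans (γ' g).symm))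
  have hb : ∀ g, toCover (b g) * ofPath (γ' g) = ofPath (γ g) := fun g => by
    refine (ofPath_loop_mul _ _).trans (ofPath_eq_iff.2 ?_)
    rw [← Path.Homotopic.Quotient.eq]
    simp [Path.Homotopic.Quotient.trans_assoc]
  refine ⟨fun g => Additive.ofMul (b g), funext fun p => ?_⟩
  obtain ⟨g, h⟩ := p
  refine Additive.toMul.injective ?_
  change b h / b (g * h) * b g = obstructionCochain γ g h / obstructionCochain γ' g h
  suffices H : obstructionCochain γ g h * b (g * h) = b g * b h * obstructionCochain γ' g h by
    rw [div_mul_eq_mul_div, div_eq_div_iff_mul_eq_mul, H, mul_comm (b h) (b g)]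
  refine toCover_injective ?_
  have e1 := toCover_obstructionCochain γ g h
  have e2 := toCover_obstructionCochain γ' g h
  rw [← mul_left_inj (ofPath (γ' (g * h))), map_mul, map_mul, map_mul, mul_assoc, hb, e1,
    mul_assoc, e2, ← hb g, ← hb h, mul_assoc, mul_assoc, ← mul_assoc (ofPath (γ' g)),
    ← toCover_central]
  simp only [mul_assoc]

variable (G) in
/-- The class `o^δ(EG) ∈ H²(BG^δ, π₁(G))` of a path connected topological group `G`. -/
def obstructionClass [PathConnectedSpace G] : H2 G (FundamentalGroup G (1 : G)) :=
  (obstructionCocycle fun g : G => PathConnectedSpace.somePath 1 g).toClass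

end Obstruction

/-- A connected manifold is path connected. -/
theorem pathConnectedSpace_of_manifold (E : Type*) [NormedAddCommGroup E] [NormedSpace ℝ E]
    (M : Type*) [TopologicalSpace M] [ChartedSpace E M] [ConnectedSpace M] :
    PathConnectedSpace M := by
  have : LocallyPathConnectedSpace M := ChartedSpace.locallyPathConnectedSpace E M
  exact pathConnectedSpace_iff_connectedSpace.2 inferInstance

end

end FlatObstruction

/-
Choose a lift `s g` in the universal cover of each `g`, with factor set `c`, and write every
element of the universal cover as `x = f x · s (π x)` with `f x` in `π₁(G)`. Since `π₁(G)` is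
central, `f (x y) = f x · f y · c (π x) (π y)`: if `c` is bounded by `C`, then `f` is a
`π₁(G)`-valued quasimorphism of defect `C`, so that `|f| ≤ (4 k + 1) C` on a product of `k`
commutators. On `π₁(G)` it differs from the identity by a constant, so `|zⁿ|` is at most
`4 C cl(zⁿ)` up to a constant. The class `o^δ(EG)` is the class of the central extension
`π₁(G) → G̃ → G`, so that every cocycle in it is the factor set of some choice of lifts, and `C` may
be taken arbitrarily close to the norm of the class. Finally, `lim |zⁿ|/n` is positive because an
element of infinite order of a finitely generated abelian group has nonzero image under some
homomorphism to `ℤ`, which is Lipschitz for the word length.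
-/

namespace FlatObstruction

open scoped commutatorElement

/-! ### Stable length of a seminorm -/

theorem tendsto_limUnder_div_of_subadditive {u : ℕ → ℝ} (h : Subadditive u) (h0 : ∀ n, 0 ≤ u n) :
    Tendsto (fun n : ℕ => u n / n) atTop (𝓝 (limUnder atTop fun n : ℕ => u n / n)) :=
  tendsto_nhds_limUnder ⟨_, h.tendsto_lim
    ⟨0, Set.forall_mem_range.2 fun n => div_nonneg (h0 n) n.cast_nonneg⟩⟩

section StableLength

variable {H : Type*} [Group H]

theorem tendsto_stableLength (p : GroupSeminorm H) (z : H) :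
    Tendsto (fun n : ℕ => p (z ^ n) / n) atTop (𝓝 (stableLength p z)) :=
  tendsto_limUnder_div_of_subadditive
    (fun m n => by simpa only [pow_add] using map_mul_le_add p (z ^ m) (z ^ n))
    fun _ => apply_nonneg p _

variable {V : Type*} [NormedAddCommGroup V]

/-- The seminorm `h ↦ ‖φ h‖` on `H` for a homomorphism `φ` to a normed space. -/
def normSeminorm (φ : Additive H →+ V) : GroupSeminorm H :=
  (normGroupSeminorm (Multiplicative V)).comp (AddMonoidHom.toMultiplicativeRight φ)

theorem normSeminorm_apply (φ : Additive H →+ V) (h : H) :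
    normSeminorm φ h = ‖φ (Additive.ofMul h)‖ :=
  rfl

variable [NormedSpace ℝ V]

theorem normSeminorm_pow (φ : Additive H →+ V) (h : H) (n : ℕ) :
    normSeminorm φ (h ^ n) = n * normSeminorm φ h := by
  rw [normSeminorm_apply, ofMul_pow, map_nsmul, ← Nat.cast_smul_eq_nsmul ℝ, norm_smul,
    Real.norm_natCast, normSeminorm_apply]

theorem stableLength_pos_of_normSeminorm_le {p : GroupSeminorm H} {φ : Additive H →+ V} {M : ℝ}
    (hM : ∀ h, normSeminorm φ h ≤ M * p h) {z : H} (hz : φ (Additive.ofMul z) ≠ 0) :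
    0 < stableLength p z := by
  have hle : normSeminorm φ z ≤ M * stableLength p z := by
    refine ge_of_tendsto ((tendsto_stableLength p z).const_mul M) ?_
    filter_upwards [eventually_gt_atTop 0] with n hn
    rw [← mul_div_assoc, le_div_iff₀ (Nat.cast_pos.2 hn), mul_comm, ← normSeminorm_pow]
    exact hM _
  have hnonneg : 0 ≤ stableLength p z :=
    ge_of_tendsto' (tendsto_stableLength p z) fun n => div_nonneg (apply_nonneg p _) n.cast_nonneg
  refine hnonneg.lt_of_ne' fun h0 => (norm_pos_iff.2 hz).not_ge ?_
  rw [h0, mul_zero] at hle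
  exact hle

end StableLength

/-! ### Word length -/

section WordLength

variable {H : Type*} [Group H] {S : Finset H}

theorem wordLength_prod_le {l : List H} (hl : ∀ x ∈ l, x ∈ S) : wordLength S l.prod ≤ l.length :=
  Nat.sInf_le ⟨l, rfl, hl, rfl⟩

theorem exists_length_eq_wordLength (symm : ∀ s ∈ S, s⁻¹ ∈ S)
    (gen : Subgroup.closure (S : Set H) = ⊤) (h : H) :
    ∃ l : List H, l.length = wordLength S h ∧ (∀ x ∈ l, x ∈ S) ∧ l.prod = h := by
  have hmem : h ∈ Submonoid.closure (S ∪ (S : Set H)⁻¹) := by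
    rw [← Subgroup.closure_toSubmonoid, gen]
    trivial
  obtain ⟨l, hl, hprod⟩ := Submonoid.exists_list_of_mem_closure hmem
  refine Nat.sInf_mem (s := {k | ∃ l : List H, l.length = k ∧ (∀ x ∈ l, x ∈ S) ∧ l.prod = h})
    ⟨_, l, rfl, fun x hx => ?_, hprod⟩
  exact (hl x hx).elim id fun hinv => by simpa using symm _ hinv

theorem wordLength_mul_le (symm : ∀ s ∈ S, s⁻¹ ∈ S) (gen : Subgroup.closure (S : Set H) = ⊤)
    (g h : H) : wordLength S (g * h) ≤ wordLength S g + wordLength S h := by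
  obtain ⟨l, hl, hlS, rfl⟩ := exists_length_eq_wordLength symm gen g
  obtain ⟨l', hl', hlS', rfl⟩ := exists_length_eq_wordLength symm gen h
  rw [← hl, ← hl', ← List.length_append, ← List.prod_append]
  exact wordLength_prod_le fun x hx => (List.mem_append.1 hx).elim (hlS x) (hlS' x)

theorem wordLength_inv_le (symm : ∀ s ∈ S, s⁻¹ ∈ S) (gen : Subgroup.closure (S : Set H) = ⊤)
    (h : H) : wordLength S h⁻¹ ≤ wordLength S h := by
  obtain ⟨l, hl, hlS, rfl⟩ := exists_length_eq_wordLength symm gen h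
  rw [← hl, List.prod_inv_reverse]
  refine (wordLength_prod_le fun x hx => ?_).trans (by simp)
  obtain ⟨y, hy, rfl⟩ := List.mem_map.1 (List.mem_reverse.1 hx)
  exact symm y (hlS y hy)

/-- The word length with respect to a finite symmetric generating set, as a seminorm. -/
noncomputable def wordSeminorm (symm : ∀ s ∈ S, s⁻¹ ∈ S)
    (gen : Subgroup.closure (S : Set H) = ⊤) : GroupSeminorm H where
  toFun h := wordLength S h
  map_one' := by
    have h : wordLength S (1 : H) ≤ 0 := wordLength_prod_le (l := []) (by simp)
    exact_mod_cast Nat.le_zero.1 h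
  mul_le' g h := by exact_mod_cast wordLength_mul_le symm gen g h
  inv' h := by
    have h' := wordLength_inv_le symm gen h⁻¹
    rw [inv_inv] at h'
    exact_mod_cast (wordLength_inv_le symm gen h).antisymm h'

theorem map_prod_le_mul_length (p : GroupSeminorm H) {M : ℝ} {l : List H}
    (hl : ∀ x ∈ l, p x ≤ M) : p l.prod ≤ M * l.length := by
  calc p l.prod ≤ (l.map p).sum :=
        l.apply_prod_le_sum_map p (map_one_eq_zero p).le (map_mul_le_add p)
    _ ≤ (l.map p).length • M := List.sum_le_card_nsmul _ _ (by simpa using hl)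
    _ = M * l.length := by rw [List.length_map, nsmul_eq_mul, mul_comm]

theorem exists_forall_le_mul_wordLength (p : GroupSeminorm H) (symm : ∀ s ∈ S, s⁻¹ ∈ S)
    (gen : Subgroup.closure (S : Set H) = ⊤) : ∃ M : ℝ, ∀ h, p h ≤ M * wordLength S h := by
  refine ⟨∑ s ∈ S, p s, fun h => ?_⟩
  obtain ⟨l, hl, hlS, rfl⟩ := exists_length_eq_wordLength symm gen h
  rw [← hl]
  exact map_prod_le_mul_length p fun x hx =>
    Finset.single_le_sum (f := p) (fun _ _ => apply_nonneg p _) (hlS x hx)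

end WordLength

theorem exists_addMonoidHom_int_ne_zero {A : Type*} [AddCommGroup A] [AddGroup.FG A] {z : A}
    (hz : ¬ IsOfFinAddOrder z) : ∃ f : A →+ ℤ, f z ≠ 0 := by
  have : Module.Finite ℤ A := Module.Finite.iff_addGroup_fg.2 inferInstance
  let q := (Submodule.torsion ℤ A).mkQ
  have hq : q z ≠ 0 := by
    intro h
    obtain ⟨a, ha⟩ := (Submodule.mem_torsion_iff z).1 ((Submodule.Quotient.mk_eq_zero _).1 h)
    exact hz (isOfFinAddOrder_iff_zsmul_eq_zero.2 ⟨a, nonZeroDivisors.ne_zero a.2, ha⟩)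
  obtain ⟨f, hf⟩ := Module.Projective.exists_dual_ne_zero ℤ hq
  exact ⟨(f ∘ₗ q).toAddMonoidHom, hf⟩

namespace IsStandardLength

variable {A : Type*} [CommGroup A] {len : A → ℝ}

theorem exists_groupSeminorm_eq (hlen : IsStandardLength len) : ∃ p : GroupSeminorm A, p = len := by
  cases hlen with
  | word S symm gen => exact ⟨wordSeminorm symm gen, rfl⟩
  | euclidean r φ inj discrete => exact ⟨normSeminorm φ, rfl⟩

theorem stableLength_pos (hlen : IsStandardLength len) {z : A} (hz : ¬ IsOfFinOrder z) :
    0 < stableLength len z := by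
  have hz' : ¬ IsOfFinAddOrder (Additive.ofMul z) := by rwa [isOfFinAddOrder_ofMul_iff]
  cases hlen with
  | word S symm gen =>
    have : Group.FG A := ⟨⟨S, gen⟩⟩
    obtain ⟨f, hf⟩ := exists_addMonoidHom_int_ne_zero hz'
    let φ : Additive A →+ ℝ := (Int.castAddHom ℝ).comp f
    obtain ⟨M, hM⟩ := exists_forall_le_mul_wordLength (normSeminorm φ) symm gen
    exact stableLength_pos_of_normSeminorm_le (p := wordSeminorm symm gen) hM
      (Int.cast_ne_zero.2 hf)
  | euclidean r φ inj discrete =>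
    have hφ : φ (Additive.ofMul z) ≠ 0 := fun h =>
      hz' ((map_eq_zero_iff φ inj).1 h ▸ IsOfFinAddOrder.zero)
    exact stableLength_pos_of_normSeminorm_le (p := normSeminorm φ)
      (fun _ => (one_mul _).ge) hφ

end IsStandardLength

/-! ### Commutator length -/

section CommutatorLength

variable {H : Type*} [Group H]

/-- The product of the commutators of a list of pairs. -/
def commutatorProd (l : List (H × H)) : H :=
  (l.map fun p => ⁅p.1, p.2⁆).prod

theorem commutatorProd_cons (x y : H) (l : List (H × H)) :
    commutatorProd ((x, y) :: l) = ⁅x, y⁆ * commutatorProd l := by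
  simp only [commutatorProd, List.map_cons, List.prod_cons]

theorem commutatorProd_append (l l' : List (H × H)) :
    commutatorProd (l ++ l') = commutatorProd l * commutatorProd l' := by
  simp only [commutatorProd, List.map_append, List.prod_append]

theorem commutatorProd_reverse_swap (l : List (H × H)) :
    commutatorProd (l.map Prod.swap).reverse = (commutatorProd l)⁻¹ := by
  simp [commutatorProd, List.prod_inv_reverse, Function.comp_def]

theorem exists_commutatorProd_eq {z : H} (hz : z ∈ commutator H) :
    ∃ l : List (H × H), commutatorProd l = z := by
  rw [commutator_eq_closure] at hz
  induction hz using Subgroup.closure_induction with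
  | mem x hx =>
    obtain ⟨a, b, rfl⟩ := hx
    exact ⟨[(a, b)], List.prod_singleton⟩
  | one => exact ⟨[], rfl⟩
  | mul x y _ _ hx hy =>
    obtain ⟨l, rfl⟩ := hx
    obtain ⟨l', rfl⟩ := hy
    exact ⟨l ++ l', commutatorProd_append l l'⟩
  | inv x _ hx =>
    obtain ⟨l, rfl⟩ := hx
    exact ⟨_, commutatorProd_reverse_swap l⟩

theorem exists_length_eq_commutatorLength {z : H} (hz : z ∈ commutator H) :
    ∃ l : List (H × H), l.length = commutatorLength z ∧ commutatorProd l = z := by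
  obtain ⟨l, hl⟩ := exists_commutatorProd_eq hz
  exact Nat.sInf_mem (s := {k | ∃ l : List (H × H), l.length = k ∧ commutatorProd l = z})
    ⟨_, l, rfl, hl⟩

theorem commutatorLength_commutatorProd_le (l : List (H × H)) :
    commutatorLength (commutatorProd l) ≤ l.length :=
  Nat.sInf_le ⟨l, rfl, rfl⟩

theorem commutatorLength_mul_le {x y : H} (hx : x ∈ commutator H) (hy : y ∈ commutator H) :
    commutatorLength (x * y) ≤ commutatorLength x + commutatorLength y := by
  obtain ⟨l, hl, rfl⟩ := exists_length_eq_commutatorLength hx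
  obtain ⟨l', hl', rfl⟩ := exists_length_eq_commutatorLength hy
  rw [← hl, ← hl', ← List.length_append, ← commutatorProd_append]
  exact commutatorLength_commutatorProd_le _

theorem tendsto_stableCommutatorLength {z : H} (hz : z ∈ commutator H) :
    Tendsto (fun n : ℕ => (commutatorLength (z ^ n) : ℝ) / n) atTop
      (𝓝 (stableCommutatorLength z)) := by
  refine tendsto_limUnder_div_of_subadditive (fun m n => ?_) fun n => Nat.cast_nonneg _
  rw [pow_add]
  exact_mod_cast commutatorLength_mul_le (pow_mem hz m) (pow_mem hz n)

end CommutatorLength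

/-! ### Quasimorphisms -/

section Quasimorphism

variable {H A : Type*} [Group H]

/-- `f` is a quasimorphism of defect at most `D`, with values in a group with a seminorm `p`. -/
def IsQuasimorphism [Group A] (p : GroupSeminorm A) (D : ℝ) (f : H → A) : Prop :=
  ∀ x y, p (f (x * y) / (f x * f y)) ≤ D

namespace IsQuasimorphism

theorem map_one_le [Group A] {p : GroupSeminorm A} {D : ℝ} {f : H → A}
    (hf : IsQuasimorphism p D f) : p (f 1) ≤ D := by
  simpa only [mul_one, div_mul_cancel_right, map_inv_eq_map] using hf 1 1

theorem map_mul_le [Group A] {p : GroupSeminorm A} {D : ℝ} {f : H → A}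
    (hf : IsQuasimorphism p D f) (x y : H) : p (f (x * y)) ≤ D + p (f x) + p (f y) :=
  calc p (f (x * y)) = p (f (x * y) / (f x * f y) * (f x * f y)) := by rw [div_mul_cancel]
    _ ≤ p (f (x * y) / (f x * f y)) + (p (f x) + p (f y)) :=
      (map_mul_le_add p _ _).trans (by gcongr; exact map_mul_le_add p _ _)
    _ ≤ D + p (f x) + p (f y) := by grw [hf x y, add_assoc]

variable [CommGroup A] {p : GroupSeminorm A} {D : ℝ} {f : H → A}

theorem map_commutator_le (hf : IsQuasimorphism p D f) (x y : H) : p (f ⁅x, y⁆) ≤ 3 * D := by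
  set a := f (x * y) / (f x * f y)
  set b := f (y * x) / (f y * f x)
  set c := f (x * y) / (f ⁅x, y⁆ * f (y * x))
  have hc : p c ≤ D := by
    have hxy : ⁅x, y⁆ * (y * x) = x * y := by rw [commutatorElement_def]; group
    simpa only [hxy] using hf ⁅x, y⁆ (y * x)
  have habc : f ⁅x, y⁆ = a / b / c := by
    simp only [a, b, c, mul_comm (f y), div_div_div_cancel_right, div_div_div_cancel_left,
      mul_div_cancel_right]
  calc p (f ⁅x, y⁆) ≤ p a + p b + p c := by
        rw [habc]
        exact (map_div_le_add p _ _).trans (by gcongr; exact map_div_le_add p _ _)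
    _ ≤ D + D + D := add_le_add (add_le_add (hf x y) (hf y x)) hc
    _ = 3 * D := by ring

theorem map_commutatorProd_le (hf : IsQuasimorphism p D f) (l : List (H × H)) :
    p (f (commutatorProd l)) ≤ (4 * l.length + 1) * D := by
  induction l with
  | nil => simpa [commutatorProd] using hf.map_one_le
  | cons q l ih =>
    obtain ⟨x, y⟩ := q
    rw [commutatorProd_cons]
    calc p (f (⁅x, y⁆ * commutatorProd l))
        ≤ D + p (f ⁅x, y⁆) + p (f (commutatorProd l)) := hf.map_mul_le _ _
      _ ≤ D + 3 * D + (4 * l.length + 1) * D := by gcongr; exact hf.map_commutator_le x y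
      _ = (4 * ((x, y) :: l).length + 1) * D := by push_cast [List.length_cons]; ring

theorem map_le_commutatorLength (hf : IsQuasimorphism p D f) {x : H} (hx : x ∈ commutator H) :
    p (f x) ≤ (4 * commutatorLength x + 1) * D := by
  obtain ⟨l, hl, rfl⟩ := exists_length_eq_commutatorLength hx
  rw [← hl]
  exact hf.map_commutatorProd_le l

end IsQuasimorphism

end Quasimorphism

/-! ### Central extensions with a bounded factor set -/

section FactorSet

variable {Γ A H : Type*} [Group Γ] [CommGroup A] [Group H] {S : GroupExtension A H Γ}

/-- `c` is the factor set of the set-theoretic section `s` of a group extension. -/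
def IsFactorSet (s : S.Section) (c : Γ → Γ → A) : Prop :=
  ∀ g h, S.inl (c g h) * s (g * h) = s g * s h

theorem exists_inl_mul_section_eq (s : S.Section) (x : H) :
    ∃ a, S.inl a * s (S.rightHom x) = x := by
  have hx : x * (s (S.rightHom x))⁻¹ ∈ S.inl.range := by
    rw [S.range_inl_eq_ker_rightHom, MonoidHom.mem_ker, map_mul, map_inv, s.rightHom_section,
      mul_inv_cancel]
  obtain ⟨a, ha⟩ := hx
  exact ⟨a, by rw [ha, inv_mul_cancel_right]⟩

/-- The coordinate in `A` of an element of the extension, for the bijection `A × Γ → H`,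
`(a, g) ↦ a · s g`, given by a section `s`. -/
noncomputable def kernelCoord (s : S.Section) (x : H) : A :=
  (exists_inl_mul_section_eq s x).choose

theorem inl_kernelCoord_mul (s : S.Section) (x : H) :
    S.inl (kernelCoord s x) * s (S.rightHom x) = x :=
  (exists_inl_mul_section_eq s x).choose_spec

theorem kernelCoord_eq_of_inl_mul_eq {s : S.Section} {a : A} {x : H}
    (h : S.inl a * s (S.rightHom x) = x) : kernelCoord s x = a :=
  S.inl_injective (mul_right_cancel ((inl_kernelCoord_mul s x).trans h.symm))

theorem kernelCoord_inl (s : S.Section) (a : A) :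
    kernelCoord s (S.inl a) = a * kernelCoord s 1 := by
  refine kernelCoord_eq_of_inl_mul_eq ?_
  have h1 := inl_kernelCoord_mul s 1
  rw [map_one] at h1
  rw [S.rightHom_inl, map_mul, mul_assoc, h1, mul_one]

namespace IsFactorSet

variable {s : S.Section} {c : Γ → Γ → A}

theorem kernelCoord_mul (hc : IsFactorSet s c) (hS : ∀ a x, Commute (S.inl a) x) (x y : H) :
    kernelCoord s (x * y) =
      kernelCoord s x * kernelCoord s y * c (S.rightHom x) (S.rightHom y) := by
  refine kernelCoord_eq_of_inl_mul_eq ?_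
  calc S.inl (kernelCoord s x * kernelCoord s y * c (S.rightHom x) (S.rightHom y)) *
        s (S.rightHom (x * y))
      = S.inl (kernelCoord s x) * (S.inl (kernelCoord s y) * s (S.rightHom x)) *
          s (S.rightHom y) := by
        simp only [map_mul, mul_assoc, hc (S.rightHom x) (S.rightHom y)]
    _ = (S.inl (kernelCoord s x) * s (S.rightHom x)) *
          (S.inl (kernelCoord s y) * s (S.rightHom y)) := by
        rw [(hS (kernelCoord s y) _).eq]
        simp only [mul_assoc]
    _ = x * y := by rw [inl_kernelCoord_mul, inl_kernelCoord_mul]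

variable {p : GroupSeminorm A} {C : ℝ} {z : A}

theorem isQuasimorphism_kernelCoord (hc : IsFactorSet s c) (hS : ∀ a x, Commute (S.inl a) x)
    (hC : ∀ g h, p (c g h) ≤ C) : IsQuasimorphism p C (kernelCoord s) := by
  intro x y
  rw [hc.kernelCoord_mul hS, mul_div_cancel_left]
  exact hC _ _

theorem le_mul_commutatorLength (hc : IsFactorSet s c) (hS : ∀ a x, Commute (S.inl a) x)
    (hC : ∀ g h, p (c g h) ≤ C) (hz : S.inl z ∈ commutator H) :
    p z ≤ (4 * commutatorLength (S.inl z) + 2) * C := by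
  have hf := hc.isQuasimorphism_kernelCoord hS hC
  calc p z = p (kernelCoord s (S.inl z) / kernelCoord s 1) := by
        rw [kernelCoord_inl, mul_div_cancel_right]
    _ ≤ p (kernelCoord s (S.inl z)) + p (kernelCoord s 1) := map_div_le_add p _ _
    _ ≤ (4 * commutatorLength (S.inl z) + 1) * C + C :=
      add_le_add (hf.map_le_commutatorLength hz) hf.map_one_le
    _ = (4 * commutatorLength (S.inl z) + 2) * C := by ring

theorem stableLength_le_mul_stableCommutatorLength (hc : IsFactorSet s c)
    (hS : ∀ a x, Commute (S.inl a) x) (hC : ∀ g h, p (c g h) ≤ C)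
    (hz : S.inl z ∈ commutator H) :
    stableLength p z ≤ 4 * C * stableCommutatorLength (S.inl z) := by
  have hlim : Tendsto (fun n : ℕ => 4 * C * ((commutatorLength (S.inl z ^ n) : ℝ) / n) + 2 * C / n)
      atTop (𝓝 (4 * C * stableCommutatorLength (S.inl z))) := by
    simpa only [add_zero] using ((tendsto_stableCommutatorLength hz).const_mul (4 * C)).add
      (tendsto_const_div_atTop_nhds_zero_nat (2 * C))
  refine le_of_tendsto_of_tendsto' (tendsto_stableLength p z) hlim fun n => ?_
  have hn : p (z ^ n) ≤ (4 * commutatorLength (S.inl z ^ n) + 2) * C := by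
    rw [← map_pow]
    exact hc.le_mul_commutatorLength hS hC (by rw [map_pow]; exact pow_mem hz n)
  calc p (z ^ n) / n ≤ (4 * commutatorLength (S.inl z ^ n) + 2) * C / n := by gcongr
    _ = 4 * C * ((commutatorLength (S.inl z ^ n) : ℝ) / n) + 2 * C / n := by ring

end IsFactorSet

end FactorSet

/-! ### The class of a central extension -/

section ExtensionClass

variable {Γ A : Type u} [Group Γ] [CommGroup A]

theorem exists_mul_eq_of_toClass_eq {c c' : Cocycle Γ A} (h : c.toClass = c'.toClass) :
    ∃ b : Γ → A, ∀ g h, c.val g h * b (g * h) = b g * b h * c'.val g h := by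
  obtain ⟨b, hb⟩ := (groupCohomology.H2π_eq_iff _ _).1 h
  let β : Γ → A := fun g => Additive.toMul (α := A) (b g)
  refine ⟨β, fun g h => ?_⟩
  have hgh : β h / β (g * h) * β g = c.val g h / c'.val g h :=
    congrArg (Additive.toMul (α := A)) (congrFun hb (g, h))
  rw [div_mul_eq_mul_div, div_eq_div_iff_mul_eq_mul] at hgh
  rw [← hgh, mul_comm (β h)]

theorem supNorm_ne_top {len : A → ℝ} {α : H2 Γ A} (h : IsBoundedClass len α) :
    supNorm len α ≠ ⊤ := by
  obtain ⟨c, hc, C, hC⟩ := h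
  refine ne_top_of_le_ne_top (ENNReal.ofReal_ne_top (r := C)) ?_
  exact (iInf₂_le c hc).trans (iSup₂_le fun g h => ENNReal.ofReal_le_ofReal (hC g h))

theorem exists_cocycle_le_of_supNorm_lt {len : A → ℝ} {α : H2 Γ A} (h : supNorm len α ≠ ⊤)
    {r : ℝ} (hr : (supNorm len α).toReal < r) :
    ∃ c : Cocycle Γ A, c.toClass = α ∧ ∀ g h, len (c.val g h) ≤ r := by
  have hr0 : 0 ≤ r := ENNReal.toReal_nonneg.trans hr.le
  have hlt : supNorm len α < ENNReal.ofReal r :=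
    (ENNReal.lt_ofReal_iff_toReal_lt h).2 hr
  obtain ⟨c, hc⟩ := iInf_lt_iff.1 hlt
  obtain ⟨hcα, hc⟩ := iInf_lt_iff.1 hc
  refine ⟨c, hcα, fun g k => (ENNReal.ofReal_le_ofReal_iff hr0).1 (le_trans ?_ hc.le)⟩
  exact le_iSup₂ (f := fun g k => ENNReal.ofReal (len (c.val g k))) g k

variable {H : Type*} [Group H] {S : GroupExtension A H Γ} {α : H2 Γ A}

variable (S α) in
/-- `α` is the class in `H²(Γ, A)` of the central extension `S` of `Γ` by `A`, that is, the class of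
the factor set of some section. -/
def IsExtensionClass : Prop :=
  ∃ (s : S.Section) (c : Cocycle Γ A), c.toClass = α ∧ IsFactorSet s c.val

namespace IsExtensionClass

theorem exists_isFactorSet (hα : IsExtensionClass S α) (hS : ∀ a x, Commute (S.inl a) x)
    {c : Cocycle Γ A} (hc : c.toClass = α) : ∃ s : S.Section, IsFactorSet s c.val := by
  obtain ⟨s, c₀, hc₀, hs⟩ := hα
  obtain ⟨b, hb⟩ := exists_mul_eq_of_toClass_eq (hc.trans hc₀.symm)
  refine ⟨⟨fun g => S.inl (b g) * s g, fun g => ?_⟩, fun g h => ?_⟩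
  · rw [map_mul, S.rightHom_inl, s.rightHom_section, one_mul]
  · calc S.inl (c.val g h) * (S.inl (b (g * h)) * s (g * h))
        = S.inl (b g) * (S.inl (b h) * s g) * s h := by
          rw [← mul_assoc, ← map_mul, hb]
          simp only [map_mul, mul_assoc, hs g h]
      _ = S.inl (b g) * s g * (S.inl (b h) * s h) := by
          rw [(hS (b h) _).eq]
          simp only [mul_assoc]

theorem stableLength_le_supNorm_mul (hα : IsExtensionClass S α)
    (hS : ∀ a x, Commute (S.inl a) x) {p : GroupSeminorm A} (hb : IsBoundedClass p α) {z : A}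
    (hz : S.inl z ∈ commutator H) :
    stableLength p z ≤ 4 * (supNorm p α).toReal * stableCommutatorLength (S.inl z) := by
  set N := (supNorm p α).toReal
  have hlim : Tendsto (fun r : ℝ => 4 * r * stableCommutatorLength (S.inl z)) (𝓝[>] N)
      (𝓝 (4 * N * stableCommutatorLength (S.inl z))) :=
    (Continuous.tendsto (by fun_prop) N).mono_left nhdsWithin_le_nhds
  refine ge_of_tendsto hlim ?_
  filter_upwards [self_mem_nhdsWithin] with r hr
  obtain ⟨c, hcα, hcr⟩ := exists_cocycle_le_of_supNorm_lt (supNorm_ne_top hb) hr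
  obtain ⟨s, hs⟩ := hα.exists_isFactorSet hS hcα
  exact hs.stableLength_le_mul_stableCommutatorLength hS hcr hz

end IsExtensionClass

end ExtensionClass

/-! ### The universal cover as a central extension -/

section UniversalCoverExtension

variable (G : Type u) [TopologicalSpace G] [Group G] [IsTopologicalGroup G] [PathConnectedSpace G]

/-- The central extension `π₁(G) → G̃ → G` of a path connected topological group `G`. -/
def universalCoverExtension : GroupExtension (FundamentalGroup G (1 : G)) (UniversalCover G) G where
  inl := toCover
  rightHom := coveringMap G
  inl_injective := toCover_injective
  range_inl_eq_ker_rightHom := range_toCover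
  rightHom_surjective g := ⟨ofPath (PathConnectedSpace.somePath 1 g), Path.target _⟩

variable {G} in
/-- The section of the covering homomorphism given by a path from `1` to each `g`. -/
def pathSection (γ : ∀ g : G, Path (1 : G) g) : (universalCoverExtension G).Section where
  toFun g := ofPath (γ g)
  rightInverse_rightHom g := (γ g).target

theorem isExtensionClass_obstructionClass :
    IsExtensionClass (universalCoverExtension G) (obstructionClass G) :=
  ⟨pathSection _, _, rfl, toCover_obstructionCochain _⟩

end UniversalCoverExtension

end FlatObstruction

open FlatObstruction in
theorem proposition3p3_general {G : Type u} [TopologicalSpace G] [Group G] [IsTopologicalGroup G]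
    [PathConnectedSpace G] {len : FundamentalGroup G (1 : G) → ℝ} (hlen : IsStandardLength len)
    (hb : IsBoundedClass len (obstructionClass G)) {z : FundamentalGroup G (1 : G)}
    (hz : ¬ IsOfFinOrder z) (hzc : toCover z ∈ commutator (UniversalCover G)) :
    Tendsto (fun n : ℕ => len (z ^ n) / n) atTop (𝓝 (stableLength len z)) ∧
      Tendsto (fun n : ℕ => (commutatorLength (toCover z ^ n) : ℝ) / n) atTop
        (𝓝 (stableCommutatorLength (toCover z))) ∧
      stableCommutatorLength (toCover z) ≥
        1 / (4 * (supNorm len (obstructionClass G)).toReal) * stableLength len z ∧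
      1 / (4 * (supNorm len (obstructionClass G)).toReal) * stableLength len z > 0 := by
  have hpos : 0 < stableLength len z := hlen.stableLength_pos hz
  obtain ⟨p, rfl⟩ := hlen.exists_groupSeminorm_eq
  set N := (supNorm p (obstructionClass G)).toReal
  have hle : stableLength p z ≤ 4 * N * stableCommutatorLength (toCover z) :=
    (isExtensionClass_obstructionClass G).stableLength_le_supNorm_mul toCover_central hb hzc
  have hN : 0 < N := ENNReal.toReal_nonneg.lt_of_ne' fun hN : N = 0 => by
    rw [hN, mul_zero, zero_mul] at hle
    exact hpos.not_ge hle
  refine ⟨tendsto_stableLength p z, tendsto_stableCommutatorLength hzc, ?_, by positivity⟩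
  rwa [ge_iff_le, one_div, inv_mul_le_iff₀ (by positivity)]

theorem proposition3p3
    {E : Type*} [NormedAddCommGroup E] [NormedSpace ℝ E] [FiniteDimensional ℝ E]
    {G : Type u} [TopologicalSpace G] [ChartedSpace E G] [Group G] [LieGroup 𝓘(ℝ, E) ∞ G]
    [ConnectedSpace G] :
    haveI : IsTopologicalGroup G := topologicalGroup_of_lieGroup 𝓘(ℝ, E) ∞
    haveI : PathConnectedSpace G := FlatObstruction.pathConnectedSpace_of_manifold E G
    ∀ len : FundamentalGroup G (1 : G) → ℝ, FlatObstruction.IsStandardLength len →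
    FlatObstruction.IsBoundedClass len (FlatObstruction.obstructionClass G) →
    ∀ z : FundamentalGroup G (1 : G), ¬ IsOfFinOrder z →
    FlatObstruction.toCover z ∈ commutator (FlatObstruction.UniversalCover G) →
      Tendsto (fun n : ℕ => len (z ^ n) / n) atTop
        (𝓝 (FlatObstruction.stableLength len z)) ∧
      Tendsto (fun n : ℕ =>
          (FlatObstruction.commutatorLength (FlatObstruction.toCover z ^ n) : ℝ) / n) atTop
        (𝓝 (FlatObstruction.stableCommutatorLength (FlatObstruction.toCover z))) ∧
      FlatObstruction.stableCommutatorLength (FlatObstruction.toCover z) ≥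
        1 / (4 * (FlatObstruction.supNorm len (FlatObstruction.obstructionClass G)).toReal) *
          FlatObstruction.stableLength len z ∧
      1 / (4 * (FlatObstruction.supNorm len (FlatObstruction.obstructionClass G)).toReal) *
          FlatObstruction.stableLength len z > 0 := by
  have : IsTopologicalGroup G := topologicalGroup_of_lieGroup 𝓘(ℝ, E) ∞
  have : PathConnectedSpace G := FlatObstruction.pathConnectedSpace_of_manifold E G
  exact fun _ hlen hb _ hz hzc => proposition3p3_general hlen hb hz hzc
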